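/- Let $0<p<1$. For $C\in\mathbb R$ consider the following Markov decision process in slots $t=0,1,2,\dots$. The states are the pairs $(x,\lambda)$ with $x\in\{1,2,\dots\}$ (the age of information of a user) and $\lambda\in\{0,1\}$ (indicating whether a packet arrives in the slot); the actions are $a=1$ (update the user) and $a=0$ (idle). If action $a$ is taken in state $(x,\lambda)$, the next state is $(x',\lambda')$, where $x'=1$ if $a=\lambda=1$ and $x'=x+1$ otherwise, and where $\lambda'$ is independent of the past with $P[\lambda'=1]=p$ and $P[\lambda'=0]=1-p$. The immediate cost is $c_C((x,\lambda),a)=(x+1-x\,a\,\lambda)+C\,a$. A policy $\mu$ (possibly history dependent and randomized) is cost-optimal if, for every initial state $\mathbf s(0)$, it minimizes the average cost $$\limsup_{T\to\infty}\frac1{T+1}\,E_\mu\Bigl[\sum_{t=0}^{T}c_C(\mathbf s(t),a(t))\Bigr]\in(-\infty,\infty]$$ among all policies. Let $\mathbf S(C)$ be the set of states where idling is optimal (ties being broken in favor of idling), that is, the set of states $\mathbf s$ such that some cost-optimal stationary deterministic policy idles in $\mathbf s$. Then for every $C\in\mathbb R$ a cost-optimal stationary deterministic policy exists, and the problem is indexable: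 as $C$ increases from $-\infty$ to $\infty$, the set $\mathbf S(C)$ increases monotonically from the empty set to the whole state space; that is, $\mathbf S(C_1)\subseteq\mathbf S(C_2)$ whenever $C_1\le C_2$, $\mathbf S(C)=\emptyset$ for some $C$ (hence for all smaller $C$), and $\bigcup_{C\in\mathbb R}\mathbf S(C)$ is the whole state space. -/

import Mathlib

noncomputable section

namespace AoI

/-- A state `(x, l)`: the age `x ≥ 1` of the user and the arrival indicator `l`
(`true` when a packet arrives in the slot). -/
abbrev State : Type := ℕ+ × Bool

/-- An action: `true` means to update the user, `false` means to idle. -/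
abbrev Action : Type := Bool

/-- The age in the next slot: `1` if the user is updated on an arrival, and `x + 1` otherwise. -/
def nextAge (s : State) (a : Action) : ℕ+ :=
  if a = true ∧ s.2 = true then 1 else s.1 + 1

/-- The law of the arrival indicator: a packet arrives with probability `p`. -/
def arrivalLaw (p : unitInterval) : PMF Bool :=
  PMF.ofFintype (fun b => ENNReal.ofReal (if b then (p : ℝ) else 1 - (p : ℝ))) (by
    rw [Fintype.sum_bool]
    simp only [if_true, Bool.false_eq_true, if_false]
    rw [← ENNReal.ofReal_add p.2.1 (sub_nonneg.2 p.2.2)]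
    simp)

/-- The transition law: the age moves to `nextAge s a`, and the new arrival indicator is
drawn independently. -/
def transition (p : unitInterval) (s : State) (a : Action) : PMF State :=
  (arrivalLaw p).map fun l => (nextAge s a, l)

/-- The immediate cost `(x + 1 - x * a * l) + C * a`. -/
def cost (C : ℝ) (s : State) (a : Action) : ℝ :=
  (((s.1 : ℕ) : ℝ) + 1 - ((s.1 : ℕ) : ℝ) * (a.toNat : ℝ) * (s.2.toNat : ℝ)) + C * (a.toNat : ℝ)

/-- The past of a slot: the list of the earlier state-action pairs, the most recent one first. -/
abbrev Past : Type := List (State × Action)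

/-- A policy, history dependent and randomized in general: the law of the action to be taken,
given the past states and actions and the current state. -/
abbrev Policy : Type := Past → State → PMF Action

/-- The stationary deterministic policy that takes the action `f s` in the state `s`. -/
def stationary (f : State → Action) : Policy := fun _ s => PMF.pure (f s)

/-- The joint law of the pairs `(s(0), a(0)), …, (s(t-1), a(t-1))` and of the state `s(t)` under
the policy `μ` with initial state `s₀`. -/
def trajLaw (p : unitInterval) (μ : Policy) (s₀ : State) : ℕ → PMF (Past × State)
  | 0 => PMF.pure ([], s₀)
  | t + 1 => (trajLaw p μ s₀ t).bind fun h =>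
      (μ h.1 h.2).bind fun a =>
        (transition p h.2 a).map fun s' => ((h.2, a) :: h.1, s')

/-- In finitely many slots only finitely many trajectories have positive probability; so the sum
in `expectedTotalCost` is a finite one. -/
theorem trajLaw_support_finite (p : unitInterval) (μ : Policy) (s₀ : State) (t : ℕ) :
    (trajLaw p μ s₀ t).support.Finite := by
  induction t with
  | zero => simp [trajLaw]
  | succ t ih =>
    simp only [trajLaw, PMF.support_bind, PMF.support_map, transition]
    refine ih.biUnion fun h _ => Set.Finite.biUnion (Set.toFinite _) fun a _ => ?_
    exact ((Set.toFinite _).image _).image _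

/-- The expected total cost `E_μ[∑_{t = 0}^{T} C(s(t), a(t))]` over the slots `0, …, T`, given
`s(0) = s₀`. -/
def expectedTotalCost (p : unitInterval) (C : ℝ) (μ : Policy) (s₀ : State) (T : ℕ) : ℝ :=
  ∑' h : Past × State,
    (trajLaw p μ s₀ (T + 1) h).toReal * (h.1.map fun y => cost C y.1 y.2).sum

/-- The average cost of a policy, `limsup_{T → ∞} (1 / (T + 1)) E_μ[∑_{t = 0}^{T} C(s(t), a(t))]`,
which can be infinite. -/
def averageCost (p : unitInterval) (C : ℝ) (μ : Policy) (s₀ : State) : EReal :=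
  Filter.limsup
    (fun T : ℕ => ((1 / ((T : ℝ) + 1) * expectedTotalCost p C μ s₀ T : ℝ) : EReal)) Filter.atTop

/-- A policy is cost-optimal if, from every initial state, it minimizes the average cost among all
policies, including history dependent and randomized ones. -/
def CostOptimal (p : unitInterval) (C : ℝ) (μ : Policy) : Prop :=
  ∀ (s₀ : State) (ν : Policy), averageCost p C μ s₀ ≤ averageCost p C ν s₀

/-- The set `S(C)` of the states where idling is optimal, a tie between the two actions being
broken in favor of idling: some cost-optimal stationary deterministic policy idles there. -/
def idleSet (p : unitInterval) (C : ℝ) : Set State :=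
  {s | ∃ f : State → Action, CostOptimal p C (stationary f) ∧ f s = false}

/-- Indexability: as `C` increases from `-∞` to `∞`, the set `S(C)` increases monotonically from
the empty set (which it equals for `C` sufficiently small) to the whole state space. -/
def Indexable (p : unitInterval) : Prop :=
  Monotone (idleSet p) ∧ (∃ C : ℝ, idleSet p C = ∅) ∧ (⋃ C : ℝ, idleSet p C) = Set.univ

end AoI

end

/-!
The dynamic program is solved explicitly. For an update price `D = max C 0`, the optimality equation
reduces to a recursion in the age alone, whose solution `relValue p (x - θ)` is a fixed increasing
function of the distance of the age `x` from a threshold `θ ≥ 0`; the normalization at age `1` says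
`relValue p (-θ) = -D`, which determines `θ` as an increasing function of `C`. For `C < 0` the
threshold is `0` and the optimal average cost is merely shifted by `C`.

What remains is to pass between the optimality equation and average costs. The total cost of any
policy differs from `(T + 1) g` by a boundary term and the accumulated losses `gap` of its actions
(`expectedTotalCost_eq_gap`). The boundary term cannot lower the average cost
(`le_averageCost_of_sum_gap`), so a stationary policy without losses is optimal
(`costOptimal_of_gap_eq_zero`). Conversely, a policy of finite average cost resets the age with
positive frequency (`exists_le_sum_reset`), and after a reset every state is reached with a
probability bounded below (`pow_mul_slotExpect_reset_le`), as the absence of packets makes the age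
grow under every policy. There are thus no transient states in which an optimal policy could act
arbitrarily, and idling is optimal in a state exactly when it entails no loss there
(`gap_eq_zero_of_costOptimal`). By `idleSet_eq_threshold` the idle set is empty for `C < 0`, and for
`C ≥ 0` it consists of the states without a packet or of age at most `θ`.
-/

open Filter Topology
noncomputable section

namespace AoI

/-! ### Expectations under finitely supported laws -/

/-- The expectation of `F` under the law `q`. It is used for laws of finite support only, for
which the sum is finite. -/
def expect {α : Type*} (q : PMF α) (F : α → ℝ) : ℝ := ∑' a, (q a).toReal * F a

section expect

variable {α β : Type*} {q : PMF α}

theorem expect_eq_sum {S : Finset α} (hS : q.support ⊆ S) (F : α → ℝ) :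
    expect q F = ∑ a ∈ S, (q a).toReal * F a := by
  refine tsum_eq_sum fun a ha => ?_
  have : a ∉ q.support := fun h => ha (hS h)
  rw [PMF.mem_support_iff, not_not] at this
  simp [this]

theorem expect_add (hq : q.support.Finite) (F G : α → ℝ) :
    expect q (fun a => F a + G a) = expect q F + expect q G := by
  have hS : q.support ⊆ hq.toFinset := by simp
  simp only [expect_eq_sum hS, mul_add, Finset.sum_add_distrib]

theorem expect_const_mul (c : ℝ) (F : α → ℝ) :
    expect q (fun a => c * F a) = c * expect q F := by
  simp only [expect, ← tsum_mul_left]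
  exact tsum_congr fun a => by ring

theorem expect_const (c : ℝ) : expect q (fun _ => c) = c := by
  rw [expect, tsum_mul_right, ← ENNReal.tsum_toReal_eq (fun a => q.apply_ne_top a), q.tsum_coe]
  simp

theorem expect_mono (hq : q.support.Finite) {F G : α → ℝ} (h : ∀ a, F a ≤ G a) :
    expect q F ≤ expect q G := by
  have hS : q.support ⊆ hq.toFinset := by simp
  simp only [expect_eq_sum hS]
  gcongr
  exact h _

theorem expect_pure (a : α) (F : α → ℝ) : expect (PMF.pure a) F = F a := by
  classical
  rw [expect, tsum_eq_single a]
  · simp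
  · intro b hb
    simp [PMF.pure_apply, hb]

theorem expect_bind {k : α → PMF β} (hq : q.support.Finite) (hk : ∀ a, (k a).support.Finite)
    (F : β → ℝ) : expect (q.bind k) F = expect q fun a => expect (k a) F := by
  classical
  have hS : q.support ⊆ hq.toFinset := by simp
  set R : Finset β := hq.toFinset.biUnion fun a => (hk a).toFinset with hR
  have hkR : ∀ a ∈ hq.toFinset, (k a).support ⊆ R := by
    intro a ha b hb
    simp only [hR, Finset.coe_biUnion, Set.mem_iUnion]
    exact ⟨a, ha, by simpa using hb⟩
  have hqR : (q.bind k).support ⊆ R := by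
    rw [PMF.support_bind]
    exact Set.iUnion₂_subset fun a ha => hkR a (by simpa using ha)
  have hbind : ∀ b, ((q.bind k) b).toReal = ∑ a ∈ hq.toFinset, (q a).toReal * (k a b).toReal := by
    intro b
    rw [PMF.bind_apply, tsum_eq_sum (s := hq.toFinset), ENNReal.toReal_sum]
    · simp only [ENNReal.toReal_mul]
    · exact fun a _ => ENNReal.mul_ne_top (q.apply_ne_top a) ((k a).apply_ne_top b)
    · intro a ha
      have : q a = 0 := by simpa using ha
      simp [this]
  rw [expect_eq_sum hqR, expect_eq_sum hS]
  simp only [hbind, Finset.sum_mul]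
  rw [Finset.sum_comm]
  refine Finset.sum_congr rfl fun a ha => ?_
  rw [expect_eq_sum (hkR a ha), Finset.mul_sum]
  exact Finset.sum_congr rfl fun b _ => by ring

theorem expect_map (f : α → β) (hq : q.support.Finite) (F : β → ℝ) :
    expect (q.map f) F = expect q fun a => F (f a) := by
  rw [PMF.map, expect_bind hq (fun a => by simp [PMF.support_pure])]
  simp only [Function.comp_apply, expect_pure]

theorem expect_arrivalLaw (p : unitInterval) (F : Bool → ℝ) :
    expect (arrivalLaw p) F = p * F true + (1 - p) * F false := by
  have h0 := p.2.1
  have h1 := sub_nonneg.2 p.2.2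
  simp only [expect, tsum_bool, arrivalLaw, PMF.ofFintype_apply, if_true, Bool.false_eq_true,
    if_false]
  rw [ENNReal.toReal_ofReal h0, ENNReal.toReal_ofReal h1]
  ring

end expect

/-! ### The state-action process slot by slot -/

/-- The expectation `E_μ[F(s(t), a(t))]` for the initial state `s₀`. -/
def slotExpect (p : unitInterval) (μ : Policy) (s₀ : State) (t : ℕ) (F : State → Action → ℝ) : ℝ :=
  expect (trajLaw p μ s₀ t) fun h => expect (μ h.1 h.2) fun a => F h.2 a

/-- The conditional expectation of `G(s(t+1))` given that action `a` is taken in state `s`. -/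
def nextExpect (p : unitInterval) (G : State → ℝ) (s : State) (a : Action) : ℝ :=
  p * G (nextAge s a, true) + (1 - p) * G (nextAge s a, false)

section slotExpect

variable {p : unitInterval} {μ : Policy} {s₀ : State} {t : ℕ}

theorem action_support_finite (q : PMF Action) : q.support.Finite := Set.toFinite _

theorem slotExpect_add (F G : State → Action → ℝ) :
    slotExpect p μ s₀ t (fun s a => F s a + G s a) =
      slotExpect p μ s₀ t F + slotExpect p μ s₀ t G := by
  simp only [slotExpect, expect_add (action_support_finite _)]
  exact expect_add (trajLaw_support_finite p μ s₀ t) _ _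

theorem slotExpect_const_mul (c : ℝ) (F : State → Action → ℝ) :
    slotExpect p μ s₀ t (fun s a => c * F s a) = c * slotExpect p μ s₀ t F := by
  simp only [slotExpect, expect_const_mul]

theorem slotExpect_const (c : ℝ) : slotExpect p μ s₀ t (fun _ _ => c) = c := by
  simp only [slotExpect, expect_const]

theorem slotExpect_sub (F G : State → Action → ℝ) :
    slotExpect p μ s₀ t (fun s a => F s a - G s a) =
      slotExpect p μ s₀ t F - slotExpect p μ s₀ t G := by
  have h := slotExpect_add (p := p) (μ := μ) (s₀ := s₀) (t := t) (fun s a => F s a - G s a) G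
  simp only [sub_add_cancel] at h
  linarith

theorem slotExpect_mono {F G : State → Action → ℝ} (h : ∀ s a, F s a ≤ G s a) :
    slotExpect p μ s₀ t F ≤ slotExpect p μ s₀ t G :=
  expect_mono (trajLaw_support_finite p μ s₀ t) fun _ =>
    expect_mono (action_support_finite _) fun _ => h _ _

theorem slotExpect_nonneg {F : State → Action → ℝ} (h : ∀ s a, 0 ≤ F s a) :
    0 ≤ slotExpect p μ s₀ t F := by
  simpa only [slotExpect_const] using
    slotExpect_mono (p := p) (μ := μ) (s₀ := s₀) (t := t) (F := fun _ _ => 0) h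

theorem slotExpect_stationary (f : State → Action) (F : State → Action → ℝ) :
    slotExpect p (stationary f) s₀ t F = slotExpect p (stationary f) s₀ t fun s _ => F s (f s) := by
  simp only [slotExpect, stationary, expect_pure]

theorem slotExpect_zero (G : State → ℝ) : slotExpect p μ s₀ 0 (fun s _ => G s) = G s₀ := by
  simp only [slotExpect, expect_const, trajLaw, expect_pure]

theorem transition_support_finite (p : unitInterval) (s : State) (a : Action) :
    (transition p s a).support.Finite := by
  rw [transition, PMF.support_map]
  exact (Set.toFinite _).image _

theorem expect_transition (p : unitInterval) (s : State) (a : Action) (G : State → ℝ) :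
    expect (transition p s a) G = nextExpect p G s a := by
  rw [transition, expect_map _ (Set.toFinite _), expect_arrivalLaw, nextExpect]

theorem expect_trajLaw_succ (F : Past × State → ℝ) :
    expect (trajLaw p μ s₀ (t + 1)) F =
      expect (trajLaw p μ s₀ t) fun h => expect (μ h.1 h.2) fun a =>
        expect (transition p h.2 a) fun s' => F ((h.2, a) :: h.1, s') := by
  have hfin : ∀ (h : Past × State) (a : Action),
      ((transition p h.2 a).map fun s' => ((h.2, a) :: h.1, s')).support.Finite := by
    intro h a
    rw [PMF.support_map]
    exact (transition_support_finite p _ _).image _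
  rw [trajLaw, expect_bind (trajLaw_support_finite p μ s₀ t)]
  · congr 1
    funext h
    rw [expect_bind (action_support_finite _) (hfin h)]
    congr 1
    funext a
    rw [expect_map _ (transition_support_finite p _ _)]
  · intro h
    rw [PMF.support_bind]
    exact Set.Finite.biUnion (Set.toFinite _) fun a _ => hfin h a

/-- The Markov property in expectation: `E[G(s(t+1))] = E[E[G(s(t+1)) | s(t), a(t)]]`. -/
theorem slotExpect_succ (G : State → ℝ) :
    slotExpect p μ s₀ (t + 1) (fun s _ => G s) = slotExpect p μ s₀ t (nextExpect p G) := by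
  simp only [slotExpect, expect_const]
  rw [expect_trajLaw_succ]
  simp only [expect_transition]

theorem expectedTotalCost_eq_sum (p : unitInterval) (C : ℝ) (μ : Policy) (s₀ : State) (T : ℕ) :
    expectedTotalCost p C μ s₀ T = ∑ t ∈ Finset.range (T + 1), slotExpect p μ s₀ t (cost C) := by
  have key : ∀ n, expect (trajLaw p μ s₀ n) (fun h => (h.1.map fun y => cost C y.1 y.2).sum) =
      ∑ t ∈ Finset.range n, slotExpect p μ s₀ t (cost C) := by
    intro n
    induction n with
    | zero => simp [trajLaw, expect_pure]
    | succ n ih =>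
      rw [expect_trajLaw_succ, Finset.sum_range_succ, ← ih, add_comm]
      simp only [List.map_cons, List.sum_cons, expect_const, slotExpect]
      rw [← expect_add (trajLaw_support_finite p μ s₀ n)]
      congr 1
      funext h
      rw [expect_add (action_support_finite _), expect_const]
  exact key (T + 1)

/-- Summing the expected one-step drifts of a function of the state telescopes. -/
theorem sum_slotExpect_drift (G : State → ℝ) (T : ℕ) :
    ∑ t ∈ Finset.range T, slotExpect p μ s₀ t (fun s a => nextExpect p G s a - G s) =
      slotExpect p μ s₀ T (fun s _ => G s) - G s₀ := by
  rw [← slotExpect_zero (p := p) (μ := μ) (s₀ := s₀) G,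
    ← Finset.sum_range_sub (fun t => slotExpect p μ s₀ t fun s _ => G s)]
  refine Finset.sum_congr rfl fun t _ => ?_
  rw [slotExpect_succ, ← slotExpect_sub]

end slotExpect

/-! ### Verification with a relative value function -/

/-- The age as a real number. -/
def age (s : State) : ℝ := ((s.1 : ℕ) : ℝ)

/-- The loss of action `a` in state `s` against the candidate average cost `g` and the candidate
relative value function `h`: the defect in the optimality equation
`g + h s = min_a (cost C s a + E[h(s') | s, a])`. -/
def gap (p : unitInterval) (C g : ℝ) (h : State → ℝ) (s : State) (a : Action) : ℝ :=
  cost C s a + nextExpect p h s a - g - h s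

theorem one_le_age (s : State) : 1 ≤ age s := by
  rw [age]
  exact_mod_cast PNat.pos s.1

theorem nextExpect_age (p : unitInterval) (s : State) (a : Action) :
    nextExpect p age s a = ((nextAge s a : ℕ) : ℝ) := by
  simp only [nextExpect, age]
  ring

theorem cost_eq (C : ℝ) (s : State) (a : Action) :
    cost C s a = ((nextAge s a : ℕ) : ℝ) + C * (a.toNat : ℝ) := by
  obtain ⟨x, l⟩ := s
  cases a <;> cases l <;> simp [cost, nextAge]

theorem nextExpect_age_le_cost (p : unitInterval) (C : ℝ) (s : State) (a : Action) :
    nextExpect p age s a ≤ cost C s a + |C| := by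
  rw [nextExpect_age, cost_eq]
  cases a
  · simp
  · have := neg_abs_le C
    simp only [Bool.toNat_true, Nat.cast_one, mul_one]
    linarith

section verification

variable {p : unitInterval} {μ : Policy} {s₀ : State} {C g K : ℝ} {h : State → ℝ}

theorem expectedTotalCost_eq_gap (g : ℝ) (h : State → ℝ) (T : ℕ) :
    expectedTotalCost p C μ s₀ T =
      (T + 1) * g + h s₀ - slotExpect p μ s₀ (T + 1) (fun s _ => h s) +
        ∑ t ∈ Finset.range (T + 1), slotExpect p μ s₀ t (gap p C g h) := by
  have hc : ∀ t, slotExpect p μ s₀ t (cost C) = g + slotExpect p μ s₀ t (gap p C g h) -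
      slotExpect p μ s₀ t (fun s a => nextExpect p h s a - h s) := by
    intro t
    conv_lhs => rw [show cost C = fun s a => (g + gap p C g h s a) - (nextExpect p h s a - h s) by
      funext s a; simp only [gap]; ring]
    rw [slotExpect_sub, slotExpect_add, slotExpect_const]
  rw [expectedTotalCost_eq_sum, Finset.sum_congr rfl fun t _ => hc t, Finset.sum_sub_distrib,
    Finset.sum_add_distrib, sum_slotExpect_drift]
  simp only [Finset.sum_const, Finset.card_range, nsmul_eq_mul]
  push_cast
  ring

/-- The total cost dominates the expected sum of the ages. -/
theorem sum_age_le_expectedTotalCost (T : ℕ) :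
    ∑ t ∈ Finset.range (T + 1), slotExpect p μ s₀ (t + 1) (fun s _ => age s) ≤
      expectedTotalCost p C μ s₀ T + (T + 1) * |C| := by
  have hsum : (T + 1) * |C| = ∑ t ∈ Finset.range (T + 1), |C| := by simp
  rw [expectedTotalCost_eq_sum, hsum, ← Finset.sum_add_distrib]
  gcongr with t _
  rw [slotExpect_succ]
  refine (slotExpect_mono (nextExpect_age_le_cost p C)).trans_eq ?_
  rw [slotExpect_add, slotExpect_const]

/-- If the average cost is below `r`, then eventually so are the time averages. -/
theorem eventually_expectedTotalCost_lt {r : ℝ} (hr : averageCost p C μ s₀ < r) :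
    ∀ᶠ T : ℕ in atTop, expectedTotalCost p C μ s₀ T < (T + 1) * r := by
  filter_upwards [eventually_lt_of_limsup_lt hr] with T hT
  rw [EReal.coe_lt_coe_iff, one_div, inv_mul_lt_iff₀ (by positivity)] at hT
  exact hT

theorem averageCost_le_of_expectedTotalCost_le {c : ℝ}
    (hc : ∀ T : ℕ, expectedTotalCost p C μ s₀ T ≤ (T + 1) * g + c) :
    averageCost p C μ s₀ ≤ g := by
  have hlim : Tendsto (fun T : ℕ => ((g + c * (1 / ((T : ℝ) + 1)) : ℝ) : EReal)) atTop
      (𝓝 (g : EReal)) := by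
    refine (continuous_coe_real_ereal.tendsto g).comp ?_
    simpa using (tendsto_one_div_add_atTop_nhds_zero_nat (𝕜 := ℝ)).const_mul c |>.const_add g
  rw [averageCost, ← hlim.limsup_eq]
  refine limsup_le_limsup (Eventually.of_forall fun T => ?_)
  rw [EReal.coe_le_coe_iff]
  have hT : (0 : ℝ) < (T : ℝ) + 1 := by positivity
  calc 1 / ((T : ℝ) + 1) * expectedTotalCost p C μ s₀ T
      ≤ 1 / ((T : ℝ) + 1) * ((T + 1) * g + c) := by
        gcongr
        exact hc T
    _ = g + c * (1 / ((T : ℝ) + 1)) := by field_simp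

/-- A sequence of nonnegative reals that grows linearly has partial sums of quadratic growth. -/
theorem not_eventually_sum_le_of_linear_growth {u : ℕ → ℝ} (hu : ∀ t, 0 ≤ u t) {ε c M : ℝ}
    (hε : 0 < ε) (hlin : ∀ᶠ t : ℕ in atTop, ε * t - c ≤ u t) :
    ¬ ∀ᶠ T : ℕ in atTop, ∑ t ∈ Finset.range T, u t ≤ M * T := by
  intro hsum
  obtain ⟨T₀, h₀⟩ := eventually_atTop.1 hlin
  obtain ⟨T₁, h₁⟩ := eventually_atTop.1 hsum
  obtain ⟨N, hN⟩ := exists_nat_gt ((2 * M + c) / ε)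
  rw [div_lt_iff₀ hε] at hN
  set n := max (max T₀ T₁) (max N 1) with hn
  have hn1 : 1 ≤ n := by omega
  have hNn : (N : ℝ) ≤ n := by exact_mod_cast (by omega : N ≤ n)
  have hnpos : (0 : ℝ) < n := by exact_mod_cast hn1
  have hup := h₁ (n + n) (by omega)
  rw [Finset.sum_range_add] at hup
  have hlow : ∑ _t ∈ Finset.range n, (ε * n - c) ≤ ∑ t ∈ Finset.range n, u (n + t) := by
    refine Finset.sum_le_sum fun t _ => le_trans ?_ (h₀ (n + t) (by omega))
    push_cast
    have : 0 ≤ ε * t := by positivity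
    linarith
  rw [Finset.sum_const, Finset.card_range, nsmul_eq_mul] at hlow
  have hfirst : 0 ≤ ∑ t ∈ Finset.range n, u t := Finset.sum_nonneg fun t _ => hu t
  push_cast at hup
  have h2 : (n : ℝ) * (ε * n - c) ≤ n * (2 * M) := by linarith
  have h3 := le_of_mul_le_mul_left h2 hnpos
  nlinarith

/-- Lower bound on the average cost. The boundary term `E[h(s(T+1))]` is harmless even for policies
for which it is not `o(T)`: if it grew linearly, so would the expected age, and the average cost
would be infinite. -/
theorem le_averageCost_of_sum_gap (hhi : ∀ s, h s ≤ K * age s) {κ c : ℝ}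
    (hgap : ∀ T : ℕ, κ * T - c ≤ ∑ t ∈ Finset.range T, slotExpect p μ s₀ t (gap p C g h)) :
    ((g + κ : ℝ) : EReal) ≤ averageCost p C μ s₀ := by
  by_contra hlt
  obtain ⟨r, hr, hrg⟩ := EReal.exists_between_coe_real (not_le.1 hlt)
  rw [EReal.coe_lt_coe_iff] at hrg
  have hev := eventually_expectedTotalCost_lt hr
  set K' := |K| + 1 with hK'
  have hK'pos : 0 < K' := by positivity
  have hh : ∀ t, slotExpect p μ s₀ t (fun s _ => h s) ≤
      K' * slotExpect p μ s₀ t (fun s _ => age s) := by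
    intro t
    rw [← slotExpect_const_mul]
    refine slotExpect_mono fun s _ => (hhi s).trans ?_
    have := one_le_age s
    have := le_abs_self K
    gcongr
    linarith
  have hagenn : ∀ t, 0 ≤ slotExpect p μ s₀ t (fun s _ => age s) := fun t =>
    slotExpect_nonneg fun s _ => zero_le_one.trans (one_le_age s)
  refine not_eventually_sum_le_of_linear_growth
    (u := fun t => slotExpect p μ s₀ (t + 1) fun s _ => age s) (fun t => hagenn _)
    (ε := (g + κ - r) / K') (c := (c - h s₀) / K') (M := r + |C|)
    (div_pos (by linarith) hK'pos) ?_ ?_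
  · filter_upwards [hev] with T hT
    rw [expectedTotalCost_eq_gap g h] at hT
    have h1 := hgap (T + 1)
    have h2 := hh (T + 1)
    push_cast at h1
    rw [div_mul_eq_mul_div, ← sub_div, div_le_iff₀ hK'pos]
    nlinarith
  · obtain ⟨T₁, h₁⟩ := eventually_atTop.1 hev
    refine eventually_atTop.2 ⟨T₁ + 1, fun T hT => ?_⟩
    obtain ⟨n, rfl⟩ : ∃ n, T = n + 1 := ⟨T - 1, by omega⟩
    have h1 := sum_age_le_expectedTotalCost (p := p) (μ := μ) (s₀ := s₀) (C := C) n
    have h2 := h₁ n (by omega)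
    push_cast
    linarith

/-- A policy without losses attains the candidate average cost. -/
theorem averageCost_stationary_le {f : State → Action} (hlo : ∀ s, -K ≤ h s)
    (hf : ∀ s, gap p C g h s (f s) = 0) : averageCost p C (stationary f) s₀ ≤ g := by
  refine averageCost_le_of_expectedTotalCost_le (c := h s₀ + K) fun T => ?_
  rw [expectedTotalCost_eq_gap g h]
  have h0 : ∀ t, slotExpect p (stationary f) s₀ t (gap p C g h) = 0 := by
    intro t
    rw [slotExpect_stationary]
    simp only [hf, slotExpect_const]
  have h1 : -K ≤ slotExpect p (stationary f) s₀ (T + 1) fun s _ => h s := by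
    rw [← slotExpect_const (p := p) (μ := stationary f) (s₀ := s₀) (t := T + 1) (-K)]
    exact slotExpect_mono fun s _ => hlo s
  simp only [h0, Finset.sum_const_zero]
  linarith

theorem costOptimal_of_gap_eq_zero {f : State → Action} (hgap : ∀ s a, 0 ≤ gap p C g h s a)
    (hlo : ∀ s, -K ≤ h s) (hhi : ∀ s, h s ≤ K * age s) (hf : ∀ s, gap p C g h s (f s) = 0) :
    CostOptimal p C (stationary f) := by
  intro s₀ ν
  refine (averageCost_stationary_le hlo hf).trans ?_
  have := le_averageCost_of_sum_gap (p := p) (μ := ν) (s₀ := s₀) (C := C) (g := g) (κ := 0)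
    (c := 0) hhi fun T => by
      simpa using Finset.sum_nonneg fun t _ => slotExpect_nonneg (hgap)
  simpa using this

/-! ### Every state is visited with positive frequency -/

/-- The indicator of the event that the age is reset to `1`. -/
def reset (s : State) (a : Action) : ℝ := if a = true ∧ s.2 = true then 1 else 0

/-- A potential of the age: `∑_{1 ≤ j < x} (j - L)` at age `x`, in closed form. It vanishes
at age `1` and is bounded below, so a mean age below `L` forces resets. -/
def agePotential (L : ℝ) (s : State) : ℝ := (age s - 1) * (age s / 2 - L)

theorem neg_sq_le_agePotential (L : ℝ) (s : State) : -L ^ 2 ≤ agePotential L s := by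
  have := one_le_age s
  rw [agePotential]
  nlinarith [sq_nonneg (age s - 1 - L), sq_nonneg (age s - 1)]

/-- Without a reset the drift of the potential is exactly `age s - L`. -/
theorem agePotential_drift_le (p : unitInterval) (L : ℝ) (s : State) (a : Action) :
    nextExpect p (agePotential L) s a - agePotential L s ≤
      age s - L + (L ^ 2 + L) * reset s a := by
  by_cases hr : a = true ∧ s.2 = true
  · have h1 := neg_sq_le_agePotential L s
    have h2 := one_le_age s
    have h3 : nextExpect p (agePotential L) s a = 0 := by
      simp [nextExpect, agePotential, age, nextAge, hr]
    rw [h3, reset, if_pos hr]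
    linarith
  · have h3 : nextExpect p (agePotential L) s a = age s * ((age s + 1) / 2 - L) := by
      simp only [nextExpect, agePotential, age, nextAge, if_neg hr, PNat.add_coe, PNat.one_coe]
      push_cast
      ring
    rw [h3, reset, if_neg hr, agePotential]
    linarith

/-- If the expected ages have bounded time averages, then resets have positive frequency. -/
theorem exists_le_sum_reset {M c : ℝ} (hM : ∀ T : ℕ,
    ∑ t ∈ Finset.range T, slotExpect p μ s₀ t (fun s _ => age s) ≤ M * T + c) :
    ∃ κ > 0, ∃ c' : ℝ, ∀ T : ℕ,
      κ * T - c' ≤ ∑ t ∈ Finset.range T, slotExpect p μ s₀ t reset := by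
  set L := |M| + 1 with hL
  have hMabs := le_abs_self M
  have hL0 : 0 < L := by positivity
  set B := L ^ 2 + L with hB
  have hB0 : 0 < B := by positivity
  refine ⟨1 / B, by positivity, (L ^ 2 + agePotential L s₀ + c) / B, fun T => ?_⟩
  have h1 := sum_slotExpect_drift (p := p) (μ := μ) (s₀ := s₀) (agePotential L) T
  have h2 : -L ^ 2 ≤ slotExpect p μ s₀ T fun s _ => agePotential L s := by
    rw [← slotExpect_const (p := p) (μ := μ) (s₀ := s₀) (t := T) (-L ^ 2)]
    exact slotExpect_mono fun s _ => neg_sq_le_agePotential L s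
  have h3 : ∑ t ∈ Finset.range T, slotExpect p μ s₀ t
        (fun s a => nextExpect p (agePotential L) s a - agePotential L s) ≤
      ∑ t ∈ Finset.range T, slotExpect p μ s₀ t (fun s _ => age s) - T * L +
        B * ∑ t ∈ Finset.range T, slotExpect p μ s₀ t reset := by
    have hT : T * L = ∑ t ∈ Finset.range T, L := by simp
    rw [hT, Finset.mul_sum, ← Finset.sum_sub_distrib, ← Finset.sum_add_distrib]
    gcongr with t _
    refine (slotExpect_mono (agePotential_drift_le p L)).trans_eq ?_
    rw [slotExpect_add (fun s _ => age s - L), slotExpect_sub (fun s _ => age s),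
      slotExpect_const, slotExpect_const_mul]
  have h4 := hM T
  have hT0 : (0 : ℝ) ≤ T := Nat.cast_nonneg T
  have h5 : M * T ≤ (L - 1) * T := by gcongr; linarith
  rw [one_div_mul_eq_div, ← sub_div, div_le_iff₀ hB0]
  linarith

open Classical in
/-- Whatever the policy, after a reset the state `(k + 1, l)` is reached in `k + 1` slots with
probability at least `q ^ (k + 1)`: this happens if no packet arrives at the ages `1, …, k` and the
next arrival indicator is `l`. -/
theorem pow_mul_slotExpect_reset_le {q : ℝ} (hq0 : 0 ≤ q) (hq : q ≤ p) (hq' : q ≤ 1 - p) (l : Bool)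
    (t k : ℕ) : q ^ (k + 1) * slotExpect p μ s₀ t reset ≤
      slotExpect p μ s₀ (t + (k + 1)) fun s _ => if s = (k.succPNat, l) then 1 else 0 := by
  induction k generalizing l with
  | zero =>
    rw [← slotExpect_const_mul, zero_add, slotExpect_succ
      fun s => if s = (Nat.succPNat 0, l) then (1 : ℝ) else 0]
    refine slotExpect_mono fun s a => ?_
    by_cases hr : a = true ∧ s.2 = true
    · have h1 : (1 : ℕ+) = Nat.succPNat 0 := rfl
      cases l <;> simp [nextExpect, nextAge, reset, hr, h1, hq, hq']
    · rw [reset, if_neg hr, mul_zero, nextExpect]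
      have := hq0.trans hq
      have := hq0.trans hq'
      positivity
  | succ k ih =>
    rw [show t + (k + 1 + 1) = t + (k + 1) + 1 by ring, slotExpect_succ
      fun s => if s = (Nat.succPNat (k + 1), l) then (1 : ℝ) else 0, pow_succ', mul_assoc]
    refine (mul_le_mul_of_nonneg_left (ih false) hq0).trans ?_
    rw [← slotExpect_const_mul]
    refine slotExpect_mono fun s a => ?_
    by_cases hs : s = (k.succPNat, false)
    · have h1 : k.succPNat + 1 = (k + 1).succPNat := rfl
      subst hs
      cases l <;> simp [nextExpect, nextAge, h1, hq, hq']
    · rw [if_neg hs, mul_zero, nextExpect]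
      have := hq0.trans hq
      have := hq0.trans hq'
      positivity

/-- A cost-optimal stationary policy has no loss in any state: its average cost is finite, so it
visits every state with positive frequency and pays for a loss there. -/
theorem gap_eq_zero_of_costOptimal (hp0 : (0 : ℝ) < p) (hp1 : (p : ℝ) < 1) {f f₀ : State → Action}
    (hgap : ∀ s a, 0 ≤ gap p C g h s a) (hlo : ∀ s, -K ≤ h s) (hhi : ∀ s, h s ≤ K * age s)
    (hf₀ : ∀ s, gap p C g h s (f₀ s) = 0) (hf : CostOptimal p C (stationary f)) (s : State) :
    gap p C g h s (f s) = 0 := by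
  classical
  by_contra hne
  set δ := gap p C g h s (f s) with hδ
  have hδ0 : 0 < δ := lt_of_le_of_ne (hgap _ _) (Ne.symm hne)
  have havg : averageCost p C (stationary f) s ≤ g :=
    (hf s (stationary f₀)).trans (averageCost_stationary_le hlo hf₀)
  -- The expected ages have bounded time averages.
  obtain ⟨M, c, hM⟩ : ∃ M c : ℝ, ∀ T : ℕ, ∑ t ∈ Finset.range T,
      slotExpect p (stationary f) s t (fun s _ => age s) ≤ M * T + c := by
    have hlt : averageCost p C (stationary f) s < ((g + 1 : ℝ) : EReal) :=
      havg.trans_lt (by rw [EReal.coe_lt_coe_iff]; linarith)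
    obtain ⟨T₁, h₁⟩ := eventually_atTop.1 (eventually_expectedTotalCost_lt hlt)
    have hnn : ∀ t, 0 ≤ slotExpect p (stationary f) s t fun s _ => age s := fun t =>
      slotExpect_nonneg fun s _ => zero_le_one.trans (one_le_age s)
    set A : ℕ → ℝ := fun T => ∑ t ∈ Finset.range T,
      slotExpect p (stationary f) s t fun s _ => age s with hA
    have hmono : Monotone A := fun m n hmn => Finset.sum_le_sum_of_subset_of_nonneg
      (Finset.range_mono hmn) fun t _ _ => hnn t
    have hlarge : ∀ T, T₁ ≤ T → A T ≤ (|g + 1| + |C|) * (T + 1) + age s := by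
      intro T hT
      have h2 := sum_age_le_expectedTotalCost (p := p) (μ := stationary f) (s₀ := s) (C := C) T
      have h3 : A (T + 2) = ∑ t ∈ Finset.range (T + 1),
          slotExpect p (stationary f) s (t + 1) (fun s _ => age s) + age s := by
        simp only [hA]
        rw [Finset.sum_range_succ', slotExpect_zero]
      have h4 := hmono (show T ≤ T + 2 by omega)
      have h5 := h₁ T hT
      have h6 : ((T : ℝ) + 1) * (g + 1) ≤ (T + 1) * |g + 1| := by
        gcongr
        exact le_abs_self _
      linarith
    refine ⟨|g + 1| + |C|, (|g + 1| + |C|) * (T₁ + 1) + age s, fun T => ?_⟩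
    have hb : 0 ≤ |g + 1| + |C| := by positivity
    have hTnn : 0 ≤ (|g + 1| + |C|) * (T : ℝ) := by positivity
    rcases le_total T₁ T with hT | hT
    · have h7 : 0 ≤ (|g + 1| + |C|) * (T₁ : ℝ) := by positivity
      have := hlarge T hT
      change A T ≤ _
      linarith
    · have := (hmono hT).trans (hlarge T₁ le_rfl)
      change A T ≤ _
      linarith
  obtain ⟨κ, hκ, c', hreset⟩ := exists_le_sum_reset hM
  set q := min (p : ℝ) (1 - p) with hq
  have hq0 : 0 < q := lt_min hp0 (by linarith)
  set k := (s.1 : ℕ) - 1 with hk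
  have hs : s = (k.succPNat, s.2) := by
    refine Prod.ext (PNat.eq ?_) rfl
    have := s.1.pos
    simp only [Nat.succPNat_coe]
    omega
  set η := δ * q ^ (k + 1) with hη
  have hη0 : 0 < η := by positivity
  have hlow := le_averageCost_of_sum_gap (p := p) (μ := stationary f) (s₀ := s) (C := C) (g := g)
    (κ := η * κ) (c := η * κ * (k + 1) + η * |c'|) hhi fun T => ?_
  · have := hlow.trans havg
    rw [EReal.coe_le_coe_iff] at this
    have : 0 < η * κ := by positivity
    linarith
  have hgapnn : ∀ t, 0 ≤ slotExpect p (stationary f) s t (gap p C g h) := fun t =>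
    slotExpect_nonneg hgap
  rcases lt_or_ge T (k + 1) with hT | hT
  · have h1 : 0 ≤ ∑ t ∈ Finset.range T, slotExpect p (stationary f) s t (gap p C g h) :=
      Finset.sum_nonneg fun t _ => hgapnn t
    have h2 : (T : ℝ) ≤ k + 1 := by exact_mod_cast hT.le
    have h3 : η * κ * T ≤ η * κ * (k + 1) := by gcongr
    have h4 : 0 ≤ η * |c'| := by positivity
    linarith
  · obtain ⟨n, rfl⟩ : ∃ n, T = k + 1 + n := ⟨T - (k + 1), by omega⟩
    have hvisit : ∀ t, η * slotExpect p (stationary f) s t reset ≤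
        slotExpect p (stationary f) s (k + 1 + t) (gap p C g h) := by
      intro t
      rw [hη, mul_assoc]
      refine (mul_le_mul_of_nonneg_left (pow_mul_slotExpect_reset_le hq0.le (min_le_left _ _)
        (min_le_right _ _) s.2 t k) hδ0.le).trans ?_
      rw [← slotExpect_const_mul, slotExpect_stationary f (gap p C g h), add_comm t]
      refine slotExpect_mono fun s' _ => ?_
      rw [← hs]
      split_ifs with h'
      · rw [h', mul_one]
      · simpa using hgap s' (f s')
    have h1 : η * ∑ t ∈ Finset.range n, slotExpect p (stationary f) s t reset ≤
        ∑ t ∈ Finset.range n, slotExpect p (stationary f) s (k + 1 + t) (gap p C g h) := by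
      rw [Finset.mul_sum]
      exact Finset.sum_le_sum fun t _ => hvisit t
    have h2 : 0 ≤ ∑ t ∈ Finset.range (k + 1), slotExpect p (stationary f) s t (gap p C g h) :=
      Finset.sum_nonneg fun t _ => hgapnn t
    rw [Finset.sum_range_add]
    have h3 := mul_le_mul_of_nonneg_left (hreset n) hη0.le
    have h4 : η * c' ≤ η * |c'| := by
      gcongr
      exact le_abs_self c'
    push_cast
    linarith

/-- Given a solution of the optimality equation, the states where idling is optimal are those
where idling entails no loss. -/
theorem idleSet_eq_of_gap (hp0 : (0 : ℝ) < p) (hp1 : (p : ℝ) < 1)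
    (hgap : ∀ s a, 0 ≤ gap p C g h s a) (hmin : ∀ s, ∃ a, gap p C g h s a = 0)
    (hlo : ∀ s, -K ≤ h s) (hhi : ∀ s, h s ≤ K * age s) :
    (∃ f, CostOptimal p C (stationary f)) ∧ idleSet p C = {s | gap p C g h s false = 0} := by
  classical
  choose f₀ hf₀ using hmin
  refine ⟨⟨f₀, costOptimal_of_gap_eq_zero hgap hlo hhi hf₀⟩, Set.ext fun s => ⟨?_, fun hs => ?_⟩⟩
  · rintro ⟨f, hf, hfs⟩
    have := gap_eq_zero_of_costOptimal hp0 hp1 hgap hlo hhi hf₀ hf s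
    rwa [hfs] at this
  · refine ⟨Function.update f₀ s false, costOptimal_of_gap_eq_zero hgap hlo hhi fun s' => ?_,
      by simp⟩
    rcases eq_or_ne s' s with rfl | hne
    · simpa using hs
    · simpa [hne] using hf₀ s'

end verification

/-! ### The explicit solution of the optimality equation -/

/-- The concave function `y / p + min_{k : ℕ} ∑_{j = 1}^{k} (y + j)`; the minimum is attained at
`k = ⌊-y⌋₊`, which is how it is encoded. -/
def relValue (p y : ℝ) : ℝ :=
  y / p + (⌊-y⌋₊ * y + (⌊-y⌋₊ : ℝ) * (⌊-y⌋₊ + 1) / 2)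

theorem relValue_le (p y : ℝ) (j : ℕ) : relValue p y ≤ y / p + (j * y + (j : ℝ) * (j + 1) / 2) := by
  rw [relValue]
  set k := ⌊-y⌋₊ with hk
  have h2 : -y < k + 1 := Nat.lt_floor_add_one _
  rcases lt_trichotomy j k with h | h | h
  · have h1 : (k : ℝ) ≤ -y := Nat.floor_le (Nat.pos_of_floor_pos (by omega)).le
    have h3 : (j : ℝ) + 1 ≤ k := by exact_mod_cast h
    nlinarith
  · rw [h]
  · have h3 : (k : ℝ) + 1 ≤ j := by exact_mod_cast h
    nlinarith

theorem relValue_of_neg_one_lt {p y : ℝ} (hy : -1 < y) : relValue p y = y / p := by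
  have : ⌊-y⌋₊ = 0 := Nat.floor_eq_zero.2 (by linarith)
  simp [relValue, this]

theorem relValue_of_le_neg_one {p y : ℝ} (hy : y ≤ -1) :
    relValue p y = y + 1 - 1 / p + relValue p (y + 1) := by
  have h : ⌊-y⌋₊ = ⌊-(y + 1)⌋₊ + 1 := by
    rw [← Nat.floor_add_one (by linarith)]
    congr 1
    ring
  rw [relValue, relValue, h]
  push_cast
  ring

theorem relValue_strictMono {p : ℝ} (hp : 0 < p) : StrictMono (relValue p) := by
  intro y z hyz
  have h := relValue_le p y ⌊-z⌋₊
  have h1 : y / p < z / p := by gcongr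
  have h2 : (⌊-z⌋₊ : ℝ) * y ≤ ⌊-z⌋₊ * z := by gcongr
  rw [relValue.eq_1 p z]
  linarith

theorem relValue_zero (p : ℝ) : relValue p 0 = 0 := by simp [relValue]

theorem relValue_le_div (p y : ℝ) : relValue p y ≤ y / p := by simpa using relValue_le p y 0

theorem relValue_nonpos_iff {p y : ℝ} (hp : 0 < p) : relValue p y ≤ 0 ↔ y ≤ 0 := by
  rw [← relValue_zero p, (relValue_strictMono hp).le_iff_le, relValue_zero]

/-- The optimality equation, reduced to a recursion in the distance `y` of the age from the
threshold. -/
theorem relValue_recursion {p : ℝ} (hp : 0 < p) (y : ℝ) :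
    relValue p y =
      y + 1 - 1 / p + (p * min (relValue p (y + 1)) 0 + (1 - p) * relValue p (y + 1)) := by
  rcases le_or_gt y (-1) with hy | hy
  · rw [min_eq_left ((relValue_nonpos_iff hp).2 (by linarith)), relValue_of_le_neg_one hy]
    ring
  · have : 0 ≤ relValue p (y + 1) := by
      rw [relValue_of_neg_one_lt (by linarith)]
      exact div_nonneg (by linarith) hp.le
    rw [min_eq_right this, relValue_of_neg_one_lt hy, relValue_of_neg_one_lt (by linarith)]
    field_simp
    ring

theorem exists_relValue_neg_eq {p : ℝ} (hp : 0 < p) {D : ℝ} (hD : 0 ≤ D) :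
    ∃ θ : ℝ, 0 ≤ θ ∧ relValue p (-θ) = -D := by
  classical
  have hex : ∃ k : ℕ, D < (k + 1 : ℝ) / p + (k : ℝ) * (k + 1) / 2 := by
    obtain ⟨k, hk⟩ := exists_nat_gt (D * p)
    refine ⟨k, ?_⟩
    have h1 : D < k / p := by rwa [lt_div_iff₀ hp]
    have h2 : (k : ℝ) / p ≤ (k + 1 : ℝ) / p := by gcongr; linarith
    have h3 : (0 : ℝ) ≤ (k : ℝ) * (k + 1) / 2 := by positivity
    linarith
  -- `k` is to be the integer part of `θ`, and `θ` solves the linear equation valid on `[k, k + 1)`.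
  set k := Nat.find hex with hk
  have hlt : D < (k + 1 : ℝ) / p + (k : ℝ) * (k + 1) / 2 := Nat.find_spec hex
  have hle : (k : ℝ) / p + (k : ℝ) * (k - 1) / 2 ≤ D := by
    rcases Nat.eq_zero_or_pos k with h0 | h0
    · simpa [h0] using hD
    · have := Nat.find_min hex (m := k - 1) (by omega)
      rw [not_lt, Nat.cast_sub h0] at this
      rw [Nat.cast_one, sub_add_cancel] at this
      linarith
  have hpos : 0 < 1 / p + k := by positivity
  have hk1 : (k : ℝ) ≤ (D + (k : ℝ) * (k + 1) / 2) / (1 / p + k) := by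
    rw [le_div_iff₀ hpos]
    have : (k : ℝ) * (1 / p + k) = (k : ℝ) / p + k * k := by ring
    nlinarith
  have hk2 : (D + (k : ℝ) * (k + 1) / 2) / (1 / p + k) < k + 1 := by
    rw [div_lt_iff₀ hpos]
    have : ((k : ℝ) + 1) * (1 / p + k) = (k + 1 : ℝ) / p + k * (k + 1) := by ring
    nlinarith
  set θ := (D + (k : ℝ) * (k + 1) / 2) / (1 / p + k) with hθ
  have hθ0 : 0 ≤ θ := le_trans (by positivity) hk1
  refine ⟨θ, hθ0, ?_⟩
  have hfl : ⌊-(-θ)⌋₊ = k := by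
    rw [neg_neg]
    exact (Nat.floor_eq_iff hθ0).2 ⟨hk1, hk2⟩
  rw [relValue, hfl]
  have : θ * (1 / p + k) = D + (k : ℝ) * (k + 1) / 2 := by
    rw [hθ]; field_simp
  have h3 : -θ / p = -(θ * (1 / p)) := by ring
  rw [h3]
  linarith

/-- The relative value function for the threshold `θ`, when an update costs `D ≥ 0`. -/
def biasValue (p θ D : ℝ) (s : State) : ℝ :=
  (if s.2 = true then min (relValue p (age s - θ)) 0 else relValue p (age s - θ)) +
    (1 + D - θ - 1 / p)

section bias

variable {p : unitInterval} {C θ : ℝ}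

/-- The expected relative value of age `x + 1`; it is the optimality equation that brings in the
value at age `x`. The case `x = 0` concerns the age after a reset. -/
theorem expect_biasValue (hp0 : (0 : ℝ) < p) (D : ℝ) (x : ℕ) :
    p * biasValue p θ D (x.succPNat, true) + (1 - p) * biasValue p θ D (x.succPNat, false) =
      relValue p (x - θ) - x + D := by
  have h := relValue_recursion hp0 (x - θ)
  simp only [biasValue, age, Nat.succPNat_coe, if_true, Bool.false_eq_true, if_false]
  rw [h, show ((x.succ : ℕ) : ℝ) - θ = x - θ + 1 by push_cast; ring]
  ring

theorem nextExpect_biasValue_of_not_reset (hp0 : (0 : ℝ) < p) (D : ℝ) {s : State} {a : Action}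
    (h : ¬(a = true ∧ s.2 = true)) :
    nextExpect p (biasValue p θ D) s a = relValue p (age s - θ) - age s + D := by
  have hx : s.1 + 1 = (s.1 : ℕ).succPNat := PNat.eq rfl
  rw [nextExpect, nextAge, if_neg h, hx]
  exact expect_biasValue hp0 D s.1

theorem nextExpect_biasValue_of_reset (hp0 : (0 : ℝ) < p) {D : ℝ} (hθ : relValue p (-θ) = -D)
    (s : State) (hs : s.2 = true) :
    nextExpect p (biasValue p θ D) s true = 0 := by
  have := expect_biasValue (θ := θ) hp0 D 0
  rw [Nat.cast_zero, zero_sub, hθ] at this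
  rw [nextExpect, nextAge, if_pos ⟨rfl, hs⟩]
  exact this.trans (by ring)

/-- The loss of idling. -/
theorem gap_idle (hp0 : (0 : ℝ) < p) (s : State) :
    gap p C (θ + 1 / p + min C 0) (biasValue p θ (max C 0)) s false =
      (if s.2 = true then max (relValue p (age s - θ)) 0 else 0) + max (-C) 0 := by
  rw [gap, nextExpect_biasValue_of_not_reset hp0 _ (by simp), cost, biasValue, ← age]
  have hC : max (-C) 0 = - min C 0 := by rw [← max_neg_neg, neg_zero]
  have hm := min_add_max (relValue p (age s - θ)) 0
  rw [hC]
  split_ifs <;> simp <;> linarith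

/-- The loss of updating. -/
theorem gap_update (hp0 : (0 : ℝ) < p) (hθ : relValue p (-θ) = -max C 0) (s : State) :
    gap p C (θ + 1 / p + min C 0) (biasValue p θ (max C 0)) s true =
      if s.2 = true then max (-relValue p (age s - θ)) 0 else max C 0 := by
  have hC := min_add_max C 0
  rw [gap, cost, biasValue, ← age]
  split_ifs with hs
  · have hm : max (-relValue p (age s - θ)) 0 = -min (relValue p (age s - θ)) 0 := by
      rw [← max_neg_neg, neg_zero]
    rw [nextExpect_biasValue_of_reset hp0 hθ s hs, hs, hm]
    simp
    linarith
  · rw [nextExpect_biasValue_of_not_reset hp0 _ (by simp [hs])]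
    simp [hs]
    linarith

theorem gap_nonneg (hp0 : (0 : ℝ) < p) (hθ : relValue p (-θ) = -max C 0) (s : State) (a : Action) :
    0 ≤ gap p C (θ + 1 / p + min C 0) (biasValue p θ (max C 0)) s a := by
  cases a
  · rw [gap_idle hp0]
    split_ifs <;> positivity
  · rw [gap_update hp0 hθ]
    split_ifs <;> positivity

theorem gap_idle_eq_zero_iff (hp0 : (0 : ℝ) < p) (s : State) :
    gap p C (θ + 1 / p + min C 0) (biasValue p θ (max C 0)) s false = 0 ↔
      0 ≤ C ∧ (s.2 = true → age s ≤ θ) := by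
  have h1 : 0 ≤ if s.2 = true then max (relValue p (age s - θ)) 0 else 0 := by
    split_ifs <;> positivity
  rw [gap_idle hp0, add_eq_zero_iff_of_nonneg h1 (le_max_right _ _), max_eq_right_iff,
    neg_nonpos, and_comm]
  refine and_congr_right fun _ => ?_
  split_ifs with hs
  · rw [max_eq_right_iff, relValue_nonpos_iff hp0]
    simp [hs]
  · simp [hs]

theorem exists_gap_eq_zero (hp0 : (0 : ℝ) < p) (hθ0 : 0 ≤ θ) (hθ : relValue p (-θ) = -max C 0)
    (s : State) : ∃ a, gap p C (θ + 1 / p + min C 0) (biasValue p θ (max C 0)) s a = 0 := by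
  by_cases hidle : gap p C (θ + 1 / p + min C 0) (biasValue p θ (max C 0)) s false = 0
  · exact ⟨false, hidle⟩
  refine ⟨true, ?_⟩
  rw [gap_idle_eq_zero_iff hp0, not_and_or] at hidle
  rw [gap_update hp0 hθ]
  rcases hidle with hC | hC
  · have hC0 : max C 0 = 0 := max_eq_right (by linarith)
    have hθz : θ = 0 := by
      rw [hC0, neg_zero, ← relValue_zero p] at hθ
      have := (relValue_strictMono hp0).injective hθ
      linarith
    have h1 := one_le_age s
    have h2 : relValue p 0 < relValue p (age s - θ) := relValue_strictMono hp0 (by linarith)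
    rw [relValue_zero] at h2
    rw [hC0, max_eq_right (by linarith), ite_self]
  · push Not at hC
    have h2 : relValue p 0 < relValue p (age s - θ) := relValue_strictMono hp0 (by linarith)
    rw [relValue_zero] at h2
    rw [if_pos hC.1, max_eq_right (by linarith)]

theorem exists_biasValue_bounds (hp0 : (0 : ℝ) < p) {D : ℝ} (hD : 0 ≤ D) (hθ0 : 0 ≤ θ)
    (hθ : relValue p (-θ) = -D) :
    ∃ K, (∀ s, -K ≤ biasValue p θ D s) ∧ ∀ s, biasValue p θ D s ≤ K * age s := by
  have hpinv : 0 < 1 / (p : ℝ) := by positivity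
  refine ⟨1 + D + θ + 1 / p, fun s => ?_, fun s => ?_⟩
  · have h1 := one_le_age s
    have h2 : relValue p (-θ) < relValue p (age s - θ) := relValue_strictMono hp0 (by linarith)
    have h3 : -D ≤ min (relValue p (age s - θ)) 0 := le_min (by linarith) (by linarith)
    rw [biasValue]
    split_ifs <;> linarith
  · have h1 := one_le_age s
    have h2 := relValue_le_div p (age s - θ)
    have h3 : (age s - θ) / p ≤ age s * (1 / p) := by
      rw [div_eq_mul_one_div]
      gcongr
      linarith
    have h4 := min_le_left (relValue p (age s - θ)) 0
    have h5 : 1 + D + θ ≤ (1 + D + θ) * age s := le_mul_of_one_le_right (by positivity) h1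
    rw [biasValue]
    split_ifs <;> linarith

end bias

/-- The solution of the problem: if the threshold `θ` is related to `C` by
`relValue p (-θ) = -max C 0`, then idling is optimal exactly when `C ≥ 0` and either there is no
packet or the age is at most `θ`. -/
theorem idleSet_eq_threshold {p : unitInterval} (hp0 : (0 : ℝ) < p) (hp1 : (p : ℝ) < 1)
    {C θ : ℝ} (hθ0 : 0 ≤ θ) (hθ : relValue p (-θ) = -max C 0) :
    (∃ f, CostOptimal p C (stationary f)) ∧
      idleSet p C = {s | 0 ≤ C ∧ (s.2 = true → age s ≤ θ)} := by
  obtain ⟨K, hlo, hhi⟩ := exists_biasValue_bounds hp0 (le_max_right C 0) hθ0 hθ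
  have h := idleSet_eq_of_gap hp0 hp1 (gap_nonneg hp0 hθ) (exists_gap_eq_zero hp0 hθ0 hθ) hlo hhi
  simpa only [gap_idle_eq_zero_iff hp0] using h

end AoI

end

theorem theorem6 (p : unitInterval) (hp0 : (0 : ℝ) < (p : ℝ)) (hp1 : (p : ℝ) < 1) :
    (∀ C : ℝ, ∃ f : AoI.State → AoI.Action, AoI.CostOptimal p C (AoI.stationary f)) ∧
      AoI.Indexable p := by
  choose θ hθ0 hθ using fun C : ℝ => AoI.exists_relValue_neg_eq hp0 (le_max_right C 0)
  have hsol := fun C => AoI.idleSet_eq_threshold hp0 hp1 (hθ0 C) (hθ C)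
  have hidle := fun C => (hsol C).2
  refine ⟨fun C => (hsol C).1, fun C₁ C₂ hC s hs => ?_, ⟨-1, ?_⟩, ?_⟩
  · rw [hidle] at hs ⊢
    refine ⟨hs.1.trans hC, fun h => (hs.2 h).trans ?_⟩
    have h1 : AoI.relValue p (-θ C₂) ≤ AoI.relValue p (-θ C₁) := by
      rw [hθ, hθ, neg_le_neg_iff]
      exact max_le_max_right 0 hC
    exact neg_le_neg_iff.1 ((AoI.relValue_strictMono hp0).le_iff_le.1 h1)
  · rw [hidle]
    ext s
    simp only [Set.mem_ofPred_eq, Set.mem_empty_iff_false, iff_false]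
    rintro ⟨h, -⟩
    linarith
  · refine Set.eq_univ_of_forall fun s => Set.mem_iUnion.2 ⟨-AoI.relValue p (-AoI.age s), ?_⟩
    have hC : 0 ≤ -AoI.relValue p (-AoI.age s) :=
      neg_nonneg.2 ((AoI.relValue_nonpos_iff hp0).2 (by linarith [AoI.one_le_age s]))
    rw [hidle]
    refine ⟨hC, fun _ => ?_⟩
    have h1 := hθ (-AoI.relValue p (-AoI.age s))
    rw [max_eq_left hC, neg_neg] at h1
    exact (neg_injective ((AoI.relValue_strictMono hp0).injective h1)).ge
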